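/- Let $(\Omega,\mathcal F,P)$ be a probability space. Let $L^0(\mathcal F)$ be the ring of a.s.-equivalence classes of real random variables, $\bar L^0(\mathcal F)$ the set of a.s.-equivalence classes of $[-\infty,+\infty]$-valued random variables, both ordered by a.s. inequality (so that $\bar L^0(\mathcal F)$ is a complete lattice), and $L^0_{++}(\mathcal F)=\{\varepsilon\in L^0(\mathcal F):\varepsilon>0\text{ a.s.}\}$. Let $\tilde I_A$ be the class of the indicator function of $A\in\mathcal F$. Let $E$ be an $L^0(\mathcal F)$-module and $\mathcal P$ a family of $L^0$-seminorms on $E$, that is, of maps $\|\cdot\|:E\to L^0(\mathcal F)$ with $\|x\|\ge 0$, $\|\xi x\|=|\xi|\,\|x\|$ and $\|x+y\|\le\|x\|+\|y\|$ for all $x,y\in E$, $\xi\in L^0(\mathcal F)$; assume that $x=0$ whenever $\|x\|=0$ for all $\|\cdot\|\in\mathcal P$ (so $(E,\mathcal P)$ is a real random locally convex module). Assume that $E$ has the countable concatenation property: for every sequence $(x_n)$ in $E$ and every countable partition $(A_n)$ of $\Omega$ into members of $\mathcal F$ there is $x\in E$ with $\tilde I_{A_n}x=\tilde I_{A_n}x_n$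 for all $n$. No concatenation property of $\mathcal P$ is assumed. Let $\mathcal T_c$ be the topology on $E$ in which a set $U$ is open iff for every $x\in U$ there are a finite $Q\subseteq\mathcal P$ and $\varepsilon\in L^0_{++}(\mathcal F)$ such that $x+z\in U$ for all $z\in E$ with $\|z\|\le\varepsilon$ for every $\|\cdot\|\in Q$; equip $L^0(\mathcal F)$ with the topology obtained in this way from the single seminorm $|\cdot|$. Let $E^*_c$ be the set of continuous $L^0(\mathcal F)$-linear maps $E\to L^0(\mathcal F)$ for these topologies. Let $f:E\to\bar L^0(\mathcal F)$ be - proper: $f(x)>-\infty$ a.s. for every $x\in E$, and $|f(x_0)|<+\infty$ a.s. for some $x_0\in E$; - $\mathcal T_c$-lower semicontinuous: $\{x\in E: f(x)\le r\}$ is $\mathcal T_c$-closed for every $r\in L^0(\mathcal F)$; - $L^0(\mathcal F)$-convex: $f(\xi x+(1-\xi)y)\le\xi f(x)+(1-\xi)f(y)$ for all $x,y\in E$ and all $\xi\in L^0(\mathcal F)$ with $0\le\xi\le1$, where $0\cdot(+\infty)=0$. Define $f^*_c(g)=\bigvee\{g(x)-f(x): x\in E\}\in\bar L^0(\mathcal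 F)$ for $g\in E^*_c$, and $f^{**}_c(x)=\bigvee\{g(x)-f^*_c(g): g\in E^*_c\}\in\bar L^0(\mathcal F)$ for $x\in E$. Then $f^{**}_c=f$. -/

import Mathlib

open MeasureTheory Set

noncomputable section

namespace RandomConvex

universe u v

/-! ### The algebra `L⁰` of real random variables and the ordered set of extended real ones -/

/-- `L⁰(𝓕)`: equivalence classes of real-valued random variables modulo almost sure equality,
with Mathlib's almost sure order. -/
abbrev L0 {Ω : Type u} [MeasurableSpace Ω] (μ : Measure Ω) : Type u := Ω →ₘ[μ] ℝ

/-- Equivalence classes of extended-real-valued random variables, with the almost sure order. -/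
abbrev L0bar {Ω : Type u} [MeasurableSpace Ω] (μ : Measure Ω) : Type u := Ω →ₘ[μ] EReal

variable {Ω : Type u} [MeasurableSpace Ω] {μ : Measure Ω}

/-- `L⁰(𝓕)` is a commutative ring; the operations are Mathlib's pointwise ones. -/
instance instCommRingL0 : CommRing (L0 μ) :=
  { (inferInstance : AddCommGroup (Ω →ₘ[μ] ℝ)), (inferInstance : CommMonoid (Ω →ₘ[μ] ℝ)) with
    left_distrib := fun a b c => by
      apply AEEqFun.ext
      filter_upwards [AEEqFun.coeFn_mul a (b + c), AEEqFun.coeFn_add b c,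
        AEEqFun.coeFn_add (a * b) (a * c), AEEqFun.coeFn_mul a b, AEEqFun.coeFn_mul a c]
        with ω h1 h2 h3 h4 h5
      simp only [h1, h2, h3, h4, h5, Pi.mul_apply, Pi.add_apply, mul_add]
    right_distrib := fun a b c => by
      apply AEEqFun.ext
      filter_upwards [AEEqFun.coeFn_mul (a + b) c, AEEqFun.coeFn_add a b,
        AEEqFun.coeFn_add (a * c) (b * c), AEEqFun.coeFn_mul a c, AEEqFun.coeFn_mul b c]
        with ω h1 h2 h3 h4 h5
      simp only [h1, h2, h3, h4, h5, Pi.mul_apply, Pi.add_apply, add_mul]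
    zero_mul := fun a => by
      apply AEEqFun.ext
      filter_upwards [AEEqFun.coeFn_mul 0 a, AEEqFun.coeFn_zero (μ := μ) (β := ℝ)] with ω h1 h2
      simp only [h1, h2, Pi.mul_apply, Pi.zero_apply, zero_mul]
    mul_zero := fun a => by
      apply AEEqFun.ext
      filter_upwards [AEEqFun.coeFn_mul a 0, AEEqFun.coeFn_zero (μ := μ) (β := ℝ)] with ω h1 h2
      simp only [h1, h2, Pi.mul_apply, Pi.zero_apply, mul_zero] }

/-- `ε ∈ L⁰₊₊`, i.e. `ε > 0` on `Ω` (almost surely). -/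
def IsStrictlyPos (ε : L0 μ) : Prop := ∀ᵐ ω ∂μ, 0 < ε ω

/-- The class of the indicator function of a measurable set. -/
def ind (A : Set Ω) (hA : MeasurableSet A) : L0 μ :=
  AEEqFun.mk (A.indicator fun _ => (1 : ℝ)) (aestronglyMeasurable_const.indicator hA)

/-- The inclusion of real random variables into extended real ones. -/
def toBar (ξ : L0 μ) : L0bar μ :=
  AEEqFun.comp (fun t : ℝ => (t : EReal)) continuous_coe_real_ereal ξ

/-- The difference `ξ - η` of a real and an extended real random variable; since `ξ` is finite, no
indeterminate expression occurs. -/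
def subBar (ξ : L0 μ) (η : L0bar μ) : L0bar μ :=
  AEEqFun.comp₂Measurable (fun (s : ℝ) (t : EReal) => (s : EReal) - t)
    (by
      have h1 : Measurable fun p : ℝ × EReal => (p.1 : EReal) :=
        measurable_coe_real_ereal.comp measurable_fst
      have h2 : Measurable fun p : ℝ × EReal => -p.2 := continuous_neg.measurable.comp measurable_snd
      exact h1.add h2) ξ η

/-- Every set of extended real random variables on a probability space has a supremum
for the almost sure order. -/
theorem exists_isLUB [IsProbabilityMeasure μ] (S : Set (L0bar μ)) : ∃ s : L0bar μ, IsLUB S s := by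
  classical
  rcases S.eq_empty_or_nonempty with rfl | ⟨s₀, hs₀⟩
  · refine ⟨AEEqFun.const Ω ⊥, by simp, fun b _ => ?_⟩
    rw [← AEEqFun.coeFn_le]
    filter_upwards [AEEqFun.coeFn_const (μ := μ) Ω (⊥ : EReal)] with ω h
    simp [h]
  let ψ : EReal → ENNReal := fun t =>
    (ENNReal.orderIsoIicOneBirational (EReal.expOrderIso t) : ENNReal)
  have hψs : StrictMono ψ := fun a b hab =>
    ENNReal.orderIsoIicOneBirational.strictMono (EReal.expOrderIso.strictMono hab)
  have hψm : Measurable ψ := hψs.monotone.measurable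
  have hψ1 : ∀ t, ψ t ≤ 1 := fun t => (ENNReal.orderIsoIicOneBirational (EReal.expOrderIso t)).2
  have hmeas : ∀ w : ℕ → L0bar μ, AEMeasurable (fun ω => ⨆ n, w n ω) μ := fun w =>
    AEMeasurable.iSup fun n => (w n).aestronglyMeasurable.aemeasurable
  let F : (ℕ → L0bar μ) → ENNReal := fun w => ∫⁻ ω, ψ (⨆ n, w n ω) ∂μ
  let T : Set ENNReal := F '' {w | ∀ n, w n ∈ S}
  obtain ⟨a, -, hat, haT⟩ := exists_seq_tendsto_sSup (S := T) ⟨_, fun _ => s₀, fun _ => hs₀, rfl⟩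
    (OrderTop.bddAbove T)
  choose V hVS hVa using haT
  let W : ℕ → L0bar μ := fun n => V n.unpair.1 n.unpair.2
  have hWS : ∀ n, W n ∈ S := fun n => hVS _ _
  have hVW : ∀ k, F (V k) ≤ F W := fun k => by
    refine lintegral_mono fun ω => hψs.monotone (iSup_le fun j => ?_)
    have : V k j = W (Nat.pair k j) := by simp [W]
    rw [this]
    exact le_iSup (fun n => W n ω) _
  have hsup : sSup T ≤ F W := le_of_tendsto' hat fun k => (hVa k) ▸ hVW k
  let h : L0bar μ := AEEqFun.mk (fun ω => ⨆ n, W n ω) (hmeas W).aestronglyMeasurable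
  have hh : h =ᵐ[μ] fun ω => ⨆ n, W n ω := AEEqFun.coeFn_mk _ _
  have hub : h ∈ upperBounds S := by
    intro s hs
    let W' : ℕ → L0bar μ := fun n => Nat.casesOn n s W
    have hW'S : ∀ n, W' n ∈ S := fun n => by cases n with
      | zero => exact hs
      | succ n => exact hWS n
    have hle : ∀ ω, ψ (⨆ n, W n ω) ≤ ψ (⨆ n, W' n ω) := fun ω =>
      hψs.monotone (iSup_le fun n => le_iSup (fun n => W' n ω) (n + 1))
    have hint : F W' ≤ F W := (le_sSup (show F W' ∈ T from ⟨W', hW'S, rfl⟩)).trans hsup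
    have hfin : F W ≠ ⊤ := by
      refine ne_top_of_le_ne_top ENNReal.one_ne_top ?_
      calc F W ≤ ∫⁻ _, 1 ∂μ := lintegral_mono fun ω => hψ1 _
        _ = 1 := by simp
    have hae := ae_eq_of_ae_le_of_lintegral_le (Filter.Eventually.of_forall hle) hfin
      (hψm.comp_aemeasurable (hmeas W')) hint
    rw [← AEEqFun.coeFn_le]
    filter_upwards [hae, hh] with ω h1 h2
    rw [h2, hψs.injective h1]
    exact le_iSup (fun n => W' n ω) 0
  refine ⟨h, hub, fun b hb => ?_⟩
  rw [← AEEqFun.coeFn_le]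
  have hall : ∀ᵐ ω ∂μ, ∀ n, W n ω ≤ b ω := ae_all_iff.2 fun n =>
    AEEqFun.coeFn_le.2 (hb (hWS n))
  filter_upwards [hall, hh] with ω h1 h2
  rw [h2]
  exact iSup_le h1

/-- The supremum `⋁ S` of a set of extended real random variables for the almost sure order. -/
def esup [IsProbabilityMeasure μ] (S : Set (L0bar μ)) : L0bar μ := (exists_isLUB S).choose

theorem isLUB_esup [IsProbabilityMeasure μ] (S : Set (L0bar μ)) : IsLUB S (esup S) :=
  (exists_isLUB S).choose_spec

/-! ### Random locally convex modules -/

variable {E : Type v} [AddCommGroup E] [Module (L0 μ) E]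

/-- `L⁰`-seminorms on an `L⁰`-module. -/
structure IsL0Seminorm (p : E → L0 μ) : Prop where
  nonneg : ∀ x, 0 ≤ p x
  smul : ∀ (ξ : L0 μ) (x : E), p (ξ • x) = |ξ| * p x
  add_le : ∀ x y, p (x + y) ≤ p x + p y

/-- `(E, P)` is a real random locally convex module: `P` is a family of `L⁰`-seminorms with
`⋁ {‖x‖ : ‖·‖ ∈ P} = 0` only for `x = 0` (a supremum of nonnegative elements vanishes iff all of
them do). -/
structure IsRLCModule (P : Set (E → L0 μ)) : Prop where
  seminorm : ∀ p ∈ P, IsL0Seminorm p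
  separating : ∀ x, (∀ p ∈ P, p x = 0) → x = 0

/-- The locally `L⁰`-convex topology `𝒯_c` induced by a family `P`: a set is open iff with each of
its points `x` it contains some `x + {z : ‖z‖_Q ≤ ε}`, with `Q ⊆ P` finite,
`‖z‖_Q = ⋁ {‖z‖ : ‖·‖ ∈ Q}` and `ε ∈ L⁰₊₊`. -/
@[reducible] def topC (P : Set (E → L0 μ)) : TopologicalSpace E where
  IsOpen U := ∀ x ∈ U, ∃ Q : Set (E → L0 μ), Q ⊆ P ∧ Q.Finite ∧
    ∃ ε : L0 μ, IsStrictlyPos ε ∧ ∀ z : E, (∀ p ∈ Q, p z ≤ ε) → x + z ∈ U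
  isOpen_univ := fun _ _ => ⟨∅, empty_subset _, finite_empty, 1, by
    filter_upwards [AEEqFun.coeFn_one (μ := μ) (β := ℝ)] with ω h
    simp [h], fun _ _ => mem_univ _⟩
  isOpen_inter := by
    rintro U V hU hV x ⟨hxU, hxV⟩
    obtain ⟨Q, hQP, hQf, ε, hε, hQ⟩ := hU x hxU
    obtain ⟨R, hRP, hRf, δ, hδ, hR⟩ := hV x hxV
    refine ⟨Q ∪ R, union_subset hQP hRP, hQf.union hRf, ε ⊓ δ, ?_, fun z hz => ⟨?_, ?_⟩⟩
    · filter_upwards [hε, hδ, AEEqFun.coeFn_inf ε δ] with ω h1 h2 h3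
      rw [h3]
      exact lt_inf_iff.2 ⟨h1, h2⟩
    · exact hQ z fun p hp => (hz p (Or.inl hp)).trans inf_le_left
    · exact hR z fun p hp => (hz p (Or.inr hp)).trans inf_le_right
  isOpen_sUnion := by
    rintro 𝒰 h x ⟨U, hU, hxU⟩
    obtain ⟨Q, hQP, hQf, ε, hε, hQ⟩ := h U hU x hxU
    exact ⟨Q, hQP, hQf, ε, hε, fun z hz => ⟨U, hU, hQ z hz⟩⟩

/-- The locally `L⁰`-convex topology of `L⁰` itself, induced by the single `L⁰`-norm `|·|`. -/
@[reducible] def topL0 (μ : Measure Ω) : TopologicalSpace (L0 μ) := topC (μ := μ) {fun ξ : L0 μ => |ξ|}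

/-- The random conjugate space `E*_c`: the `L⁰`-linear maps `E → L⁰` which are continuous for the
locally `L⁰`-convex topologies. -/
def dualC (P : Set (E → L0 μ)) : Set (E →ₗ[L0 μ] L0 μ) :=
  {g | @Continuous E (L0 μ) (topC P) (topL0 μ) g}

variable (μ E) in
/-- `E` has the countable concatenation property: for every countable measurable partition
`(A n)` of `Ω` and every sequence `(x n)` in `E` there is `y` in `E` with
`1_{A n} y = 1_{A n} x n` for all `n`. -/
def HasCountableConcatenation : Prop :=
  ∀ (A : ℕ → Set Ω) (hA : ∀ n, MeasurableSet (A n)), Pairwise (fun m n => Disjoint (A m) (A n)) →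
    ⋃ n, A n = univ → ∀ x : ℕ → E, ∃ y : E, ∀ n,
      (ind (A n) (hA n) : L0 μ) • y = (ind (A n) (hA n) : L0 μ) • x n

/-! ### Functions with values in the extended random variables -/

/-- `f` is proper: `|f x₀| < +∞` on `Ω` for some `x₀`, and `f x > -∞` on `Ω` for all `x`. -/
def IsProper (f : E → L0bar μ) : Prop :=
  (∃ x₀, ∀ᵐ ω ∂μ, f x₀ ω ≠ ⊥ ∧ f x₀ ω ≠ ⊤) ∧ ∀ x, ∀ᵐ ω ∂μ, ⊥ < f x ω

/-- `L⁰`-convexity, `f(ξx + (1-ξ)y) ≤ ξ f(x) + (1-ξ) f(y)` for `0 ≤ ξ ≤ 1`, with `0 * ∞ = 0`.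
Only used for functions with values `> -∞`, so that `∞ - ∞` does not occur. -/
def IsL0Convex (f : E → L0bar μ) : Prop :=
  ∀ (x y : E) (ξ : L0 μ), 0 ≤ ξ → ξ ≤ 1 → ∀ᵐ ω ∂μ,
    f (ξ • x + (1 - ξ) • y) ω ≤ ((ξ ω : ℝ) : EReal) * f x ω + ((1 - ξ ω : ℝ) : EReal) * f y ω

/-- `𝒯_c`-lower semicontinuity: all sublevel sets `{x : f x ≤ r}`, `r ∈ L⁰`, are `𝒯_c`-closed. -/
def IsLscC (P : Set (E → L0 μ)) (f : E → L0bar μ) : Prop :=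
  ∀ r : L0 μ, @IsClosed E (topC P) {x | f x ≤ toBar r}

/-- The `𝒯_c`-conjugate `f*_c(g) = ⋁ {g(x) - f(x) : x ∈ E}` for `g ∈ E*_c`. -/
def conjC [IsProbabilityMeasure μ] (P : Set (E → L0 μ)) (f : E → L0bar μ) (g : dualC P) : L0bar μ :=
  esup (range fun x : E => subBar (g.1 x) (f x))

/-- The `𝒯_c`-biconjugate `f**_c(x) = ⋁ {g(x) - f*_c(g) : g ∈ E*_c}`. -/
def biconjC [IsProbabilityMeasure μ] (P : Set (E → L0 μ)) (f : E → L0bar μ) (x : E) : L0bar μ :=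
  esup (range fun g : dualC P => subBar (g.1 x) (conjC P f g))

end RandomConvex

end

/-!
The inequality `f** ≤ f` is formal. For the converse, suppose that `f** x < f x` on a set `A` of
positive probability. It is enough to find, on some smaller set `D` of positive probability, a
constant `c` with `f** x < c` and a map `g ∈ E*_c` with `c + g (y - x) ≤ f y` on `D` for all `y`: such an
affine minorant forces `c ≤ f** x` on `D` (`le_biconjC`).

Passing to smaller sets replaces every concatenation property of the family of seminorms. Choose a
rational `c` that lies strictly between `f** x` and `f x` on a set of positive probability. Closedness of
sublevel sets gives a finite family of seminorms and a ball around `x` (after modification off that set)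
on which `f ≤ c` fails, though only on an event that depends on the point of the ball. As `E` has the
countable concatenation property and `f` is local, there is a point of the ball at which the event
`f ≤ c` is largest; on the complement `D` of this event, `f > c` holds on the whole ball
(`exists_lt_on_ball`).

To turn this into a bound `c - q (y - x) ≤ f y` with a continuous `L⁰`-seminorm `q`, the same local
statement is first used at a point `x₀` where `f` is finite; there convexity extends a bound on a ball to
all of `E` (`IsL0Convex.exists_lower_bound_of_finite`), and the resulting global bound takes care of the
points outside the ball around `x`, where `f x` may be infinite
(`IsL0Convex.exists_lower_bound_of_ball`).

Finally the seminorm is replaced by a linear map with the sandwich form of the random Hahn–Banach theorem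
(`IsL0Seminorm.exists_linearMap_le_of_convex`). That theorem is proved without extending linear maps from
submodules: by Zorn's lemma and conditional completeness of `L⁰` there are minimal `L⁰`-sublinear maps, and
a minimal one is linear. A map dominated by a continuous `L⁰`-seminorm is in `E*_c`
(`IsContinuousL0Seminorm.mem_dualC`).
-/

open MeasureTheory Set

namespace RandomConvex

universe u v

variable {Ω : Type u} [MeasurableSpace Ω] {μ : Measure Ω}

/-! ### The ordered ring `L⁰` -/

namespace L0

theorem coe_add (a b : L0 μ) : ∀ᵐ ω ∂μ, (a + b) ω = a ω + b ω := AEEqFun.coeFn_add a b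

theorem coe_sub (a b : L0 μ) : ∀ᵐ ω ∂μ, (a - b) ω = a ω - b ω := AEEqFun.coeFn_sub a b

theorem coe_mul (a b : L0 μ) : ∀ᵐ ω ∂μ, (a * b) ω = a ω * b ω := AEEqFun.coeFn_mul a b

theorem coe_neg (a : L0 μ) : ∀ᵐ ω ∂μ, (-a) ω = -a ω := AEEqFun.coeFn_neg a

theorem coe_zero : ∀ᵐ ω ∂μ, (0 : L0 μ) ω = 0 := AEEqFun.coeFn_zero (μ := μ) (β := ℝ)

theorem coe_one : ∀ᵐ ω ∂μ, (1 : L0 μ) ω = 1 := AEEqFun.coeFn_one (μ := μ) (β := ℝ)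

theorem le_iff {a b : L0 μ} : a ≤ b ↔ ∀ᵐ ω ∂μ, a ω ≤ b ω := AEEqFun.coeFn_le.symm

theorem nonneg_iff {a : L0 μ} : 0 ≤ a ↔ ∀ᵐ ω ∂μ, 0 ≤ a ω := by
  rw [le_iff]
  constructor <;> intro h <;> filter_upwards [h, coe_zero (μ := μ)] with ω h1 h2
  · rwa [h2] at h1
  · rwa [h2]

instance instIsOrderedRing : IsOrderedRing (L0 μ) :=
  haveI : IsOrderedAddMonoid (L0 μ) :=
    { add_le_add_left := fun a b h c => by
        rw [le_iff] at h ⊢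
        filter_upwards [h, coe_add a c, coe_add b c] with ω h1 h2 h3
        rw [h2, h3]
        linarith }
  haveI : ZeroLEOneClass (L0 μ) :=
    ⟨nonneg_iff.2 (by filter_upwards [coe_one (μ := μ)] with ω h; rw [h]; exact zero_le_one)⟩
  IsOrderedRing.of_mul_nonneg
    fun a b ha hb => by
      rw [nonneg_iff] at *
      filter_upwards [ha, hb, coe_mul a b] with ω h1 h2 h3
      rw [h3]
      exact mul_nonneg h1 h2

theorem exists_coe_eq {φ : Ω → ℝ} (hφ : Measurable φ) : ∃ a : L0 μ, ∀ᵐ ω ∂μ, a ω = φ ω :=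
  ⟨AEEqFun.mk φ hφ.aestronglyMeasurable, AEEqFun.coeFn_mk _ _⟩

/-- Division of a strictly positive random variable by one plus a nonnegative one; this yields both
inverses and radii of neighbourhoods. -/
theorem exists_mul_one_add_eq {ε K : L0 μ} (hε : IsStrictlyPos ε) (hK : 0 ≤ K) :
    ∃ δ : L0 μ, IsStrictlyPos δ ∧ δ * (1 + K) = ε := by
  obtain ⟨δ, hδ⟩ := exists_coe_eq (μ := μ) (φ := fun ω => ε ω / (1 + K ω))
    (ε.measurable.div (measurable_const.add K.measurable))
  rw [nonneg_iff] at hK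
  refine ⟨δ, ?_, AEEqFun.ext ?_⟩
  · filter_upwards [hδ, hε, hK] with ω h1 h2 h3
    rw [h1]
    positivity
  · filter_upwards [hδ, hK, coe_mul δ (1 + K), coe_add 1 K, coe_one (μ := μ)] with ω h1 h2 h3 h4 h5
    rw [h3, h4, h5, h1]
    field_simp

/-- Weights of convex combinations with nonnegative coefficients `s`, `t`. Where `s = t = 0` the
weight is irrelevant. -/
theorem exists_weight {s t : L0 μ} (hs : 0 ≤ s) (ht : 0 ≤ t) :
    ∃ ξ : L0 μ, 0 ≤ ξ ∧ ξ ≤ 1 ∧ (s + t) * ξ = s := by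
  obtain ⟨ξ, hξ⟩ := exists_coe_eq (μ := μ) (φ := fun ω => s ω / (s ω + t ω))
    (s.measurable.div (s.measurable.add t.measurable))
  rw [nonneg_iff] at hs ht
  refine ⟨ξ, nonneg_iff.2 ?_, le_iff.2 ?_, AEEqFun.ext ?_⟩
  · filter_upwards [hξ, hs, ht] with ω h1 h2 h3
    rw [h1]
    positivity
  · filter_upwards [hξ, hs, ht, coe_one (μ := μ)] with ω h1 h2 h3 h4
    rw [h1, h4]
    exact div_le_one_of_le₀ (by linarith) (by linarith)
  · filter_upwards [hξ, hs, ht, coe_mul (s + t) ξ, coe_add s t] with ω h1 h2 h3 h4 h5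
    rw [h4, h5, h1]
    rcases (add_nonneg h2 h3).eq_or_lt with h | h
    · have : s ω = 0 := by linarith
      simp [this]
    · field_simp

theorem coe_toBar (a : L0 μ) : ∀ᵐ ω ∂μ, toBar a ω = (a ω : EReal) := AEEqFun.coeFn_comp _ _ a

/-- `L⁰` is conditionally complete. -/
theorem exists_isGLB [IsProbabilityMeasure μ] {S : Set (L0 μ)} (hS : S.Nonempty)
    (hb : BddBelow S) : ∃ a, IsGLB S a := by
  obtain ⟨a₀, ha₀⟩ := hS
  obtain ⟨b, hb⟩ := hb
  obtain ⟨s, hs⟩ := exists_isLUB ((fun a : L0 μ => toBar (-a)) '' S)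
  obtain ⟨I, hI⟩ := exists_coe_eq (μ := μ) (φ := fun ω => -(s ω).toReal)
    (measurable_ereal_toReal.comp s.measurable).neg
  have hle : ∀ c ∈ lowerBounds S, ∀ᵐ ω ∂μ, s ω ≤ ((-c ω : ℝ) : EReal) := by
    intro c hc
    have h : s ≤ toBar (-c) := hs.2 (by
      rintro _ ⟨a, ha, rfl⟩
      rw [← AEEqFun.coeFn_le]
      filter_upwards [coe_toBar (-a), coe_toBar (-c), coe_neg a, coe_neg c, le_iff.1 (hc ha)]
        with ω h1 h2 h3 h4 h5
      rw [h1, h2, h3, h4]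
      exact_mod_cast neg_le_neg h5)
    filter_upwards [AEEqFun.coeFn_le.2 h, coe_toBar (-c), coe_neg c] with ω h1 h2 h3
    rwa [h2, h3] at h1
  have hge : ∀ a ∈ S, ∀ᵐ ω ∂μ, ((-a ω : ℝ) : EReal) ≤ s ω := by
    intro a ha
    filter_upwards [AEEqFun.coeFn_le.2 (hs.1 ⟨a, ha, rfl⟩), coe_toBar (-a), coe_neg a]
      with ω h1 h2 h3
    rwa [h2, h3] at h1
  have hs' : ∀ᵐ ω ∂μ, s ω = ((-I ω : ℝ) : EReal) := by
    filter_upwards [hle b hb, hge a₀ ha₀, hI] with ω h1 h2 h3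
    rw [h3, neg_neg, EReal.coe_toReal]
    · exact ne_top_of_le_ne_top (EReal.coe_ne_top _) h1
    · exact ne_bot_of_le_ne_bot (EReal.coe_ne_bot _) h2
  refine ⟨I, fun a ha => le_iff.2 ?_, fun c hc => le_iff.2 ?_⟩
  · filter_upwards [hge a ha, hs'] with ω h1 h2
    rw [h2] at h1
    exact neg_le_neg_iff.1 (EReal.coe_le_coe_iff.1 h1)
  · filter_upwards [hle c hc, hs'] with ω h1 h2
    rw [h2] at h1
    exact neg_le_neg_iff.1 (EReal.coe_le_coe_iff.1 h1)

/-- Multiplication by a nonnegative `ξ` respects infima. Since `ξ` may vanish on a set of positive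
probability, a lower bound of `ξ • S` is divided by `ξ` only where `ξ > 0`. -/
theorem le_mul_of_isGLB {S : Set (L0 μ)} {a b ξ : L0 μ} (hS : S.Nonempty) (ha : IsGLB S a)
    (hξ : 0 ≤ ξ) (hb : ∀ s ∈ S, b ≤ ξ * s) : b ≤ ξ * a := by
  classical
  obtain ⟨c, hc⟩ := exists_coe_eq (μ := μ) (φ := fun ω => if 0 < ξ ω then b ω / ξ ω else a ω)
    (Measurable.ite (measurableSet_lt measurable_const ξ.measurable)
      (b.measurable.div ξ.measurable) a.measurable)
  have hca : c ≤ a := ha.2 fun s hs => le_iff.2 (by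
    filter_upwards [hc, le_iff.1 (hb s hs), coe_mul ξ s, le_iff.1 (ha.1 hs)] with ω h1 h2 h3 h4
    rw [h1]
    split_ifs with h
    · rw [div_le_iff₀ h]
      linarith
    · exact h4)
  obtain ⟨s, hs⟩ := hS
  rw [le_iff]
  filter_upwards [hc, le_iff.1 hca, coe_mul ξ a, le_iff.1 (hb s hs), coe_mul ξ s,
    nonneg_iff.1 hξ] with ω h1 h2 h3 h4 h5 h6
  rw [h3]
  rcases h6.eq_or_lt with h | h
  · rw [h5, ← h] at h4
    rw [← h]
    linarith
  · rw [h1, if_pos h, div_le_iff₀ h] at h2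
    linarith

end L0

/-! ### The random Hahn–Banach theorem -/

section HahnBanach

variable {E : Type v} [AddCommGroup E] [Module (L0 μ) E]

/-- `L⁰`-sublinear maps. Only one inequality is required in `p (ξ • x) = ξ * p x`, `0 ≤ ξ`: it is
the one that passes to infima, and it implies the other one (`IsL0Sublinear.mul_le_smul`). -/
structure IsL0Sublinear (p : E → L0 μ) : Prop where
  add_le : ∀ x y, p (x + y) ≤ p x + p y
  smul_le : ∀ (ξ : L0 μ) (x : E), 0 ≤ ξ → p (ξ • x) ≤ ξ * p x

namespace IsL0Sublinear

variable {p : E → L0 μ}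

theorem zero (hp : IsL0Sublinear p) : p 0 = 0 := by
  refine le_antisymm ?_ ?_
  · simpa using hp.smul_le 0 0 le_rfl
  · simpa using hp.add_le 0 0

theorem neg_le (hp : IsL0Sublinear p) (x : E) : -p (-x) ≤ p x := by
  have h := hp.add_le x (-x)
  rw [add_neg_cancel, hp.zero] at h
  exact neg_le_iff_add_nonneg.2 h

theorem mul_le_smul (hp : IsL0Sublinear p) {ξ : L0 μ} (hξ : 0 ≤ ξ) (x : E) :
    ξ * p x ≤ p (ξ • x) := by
  -- `ξ` need not be invertible, but `1 + ξ` is.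
  have hone : IsStrictlyPos (1 : L0 μ) := by
    filter_upwards [L0.coe_one (μ := μ)] with ω h
    rw [h]
    exact one_pos
  obtain ⟨δ, hδ, hδξ⟩ := L0.exists_mul_one_add_eq hone hξ
  have hδ0 : 0 ≤ δ := L0.nonneg_iff.2 (by filter_upwards [hδ] with ω h using h.le)
  have h1 : p x ≤ δ * p ((1 + ξ) • x) := by
    have := hp.smul_le δ ((1 + ξ) • x) hδ0
    rwa [smul_smul, hδξ, one_smul] at this
  have h2 : (1 + ξ) * p x ≤ p ((1 + ξ) • x) := by
    have := mul_le_mul_of_nonneg_left h1 (add_nonneg zero_le_one hξ)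
    rwa [← mul_assoc, mul_comm (1 + ξ) δ, hδξ, one_mul] at this
  have h3 : p ((1 + ξ) • x) ≤ p x + p (ξ • x) := by
    rw [add_smul, one_smul]
    exact hp.add_le _ _
  have h4 := h2.trans h3
  rw [add_mul, one_mul] at h4
  exact le_of_add_le_add_left h4

end IsL0Sublinear

/-- The pointwise infimum of sets `S x` that are compatible with addition and with multiplication by
nonnegative scalars is `L⁰`-sublinear. -/
theorem exists_isL0Sublinear_isGLB [IsProbabilityMeasure μ] (S : E → Set (L0 μ))
    (hne : ∀ x, (S x).Nonempty) (hb : ∀ x, BddBelow (S x))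
    (hadd : ∀ x y, ∀ a ∈ S x, ∀ b ∈ S y, ∃ c ∈ S (x + y), c ≤ a + b)
    (hsmul : ∀ (ξ : L0 μ) (x : E), 0 ≤ ξ → ∀ a ∈ S x, ∃ c ∈ S (ξ • x), c ≤ ξ * a) :
    ∃ p : E → L0 μ, IsL0Sublinear p ∧ ∀ x, IsGLB (S x) (p x) := by
  choose p hp using fun x => L0.exists_isGLB (hne x) (hb x)
  refine ⟨p, ⟨fun x y => ?_, fun ξ x hξ => ?_⟩, hp⟩
  · have h1 : ∀ a ∈ S x, p (x + y) - a ≤ p y := fun a ha => (hp y).2 fun b hb => by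
      obtain ⟨c, hc, hcab⟩ := hadd x y a ha b hb
      exact sub_le_iff_le_add'.2 (((hp _).1 hc).trans hcab)
    have h2 : p (x + y) - p y ≤ p x := (hp x).2 fun a ha => sub_le_comm.1 (h1 a ha)
    exact sub_le_iff_le_add.1 h2
  · refine L0.le_mul_of_isGLB (hne x) (hp x) hξ fun a ha => ?_
    obtain ⟨c, hc, hca⟩ := hsmul ξ x hξ a ha
    exact ((hp _).1 hc).trans hca

/-- By Zorn's lemma there is a minimal `L⁰`-sublinear map below a given one. -/
theorem IsL0Sublinear.exists_minimal [IsProbabilityMeasure μ] {p₀ : E → L0 μ}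
    (hp₀ : IsL0Sublinear p₀) :
    ∃ p : E → L0 μ, IsL0Sublinear p ∧ p ≤ p₀ ∧ ∀ p', IsL0Sublinear p' → p' ≤ p → p ≤ p' := by
  obtain ⟨⟨m, hm, hm0⟩, hmax⟩ := exists_maximal_of_chains_bounded
    (α := {p : E → L0 μ // IsL0Sublinear p ∧ p ≤ p₀}) (r := fun p p' => p'.1 ≤ p.1)
    (fun c hc => by
      rcases c.eq_empty_or_nonempty with rfl | ⟨m, hmc⟩
      · exact ⟨⟨p₀, hp₀, le_rfl⟩, by simp⟩
      have hdir : ∀ p ∈ c, ∀ p' ∈ c, ∃ r ∈ c, r.1 ≤ p.1 ∧ r.1 ≤ p'.1 := by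
        intro p hp p' hp'
        rcases eq_or_ne p p' with rfl | hne
        · exact ⟨p, hp, le_rfl, le_rfl⟩
        · rcases hc hp hp' hne with h | h
          · exact ⟨p', hp', h, le_rfl⟩
          · exact ⟨p, hp, le_rfl, h⟩
      obtain ⟨q, hq, hglb⟩ := exists_isL0Sublinear_isGLB (fun x => (fun p => p.1 x) '' c)
        (fun x => ⟨_, m, hmc, rfl⟩)
        (fun x => ⟨-p₀ (-x), by
          rintro _ ⟨p, hp, rfl⟩
          exact (neg_le_neg (p.2.2 (-x))).trans (p.2.1.neg_le x)⟩)
        (by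
          rintro x y _ ⟨p, hp, rfl⟩ _ ⟨p', hp', rfl⟩
          obtain ⟨r, hr, h1, h2⟩ := hdir p hp p' hp'
          exact ⟨_, ⟨r, hr, rfl⟩, (r.2.1.add_le x y).trans (add_le_add (h1 x) (h2 y))⟩)
        (by
          rintro ξ x hξ _ ⟨p, hp, rfl⟩
          exact ⟨_, ⟨p, hp, rfl⟩, p.2.1.smul_le ξ x hξ⟩)
      have hle : ∀ p ∈ c, q ≤ p.1 := fun p hp x => (hglb x).1 ⟨p, hp, rfl⟩
      exact ⟨⟨q, hq, (hle m hmc).trans m.2.2⟩, hle⟩)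
    (fun h1 h2 => h2.trans h1)
  exact ⟨m, hm, hm0, fun p' hp' hle => hmax ⟨p', hp', hle.trans hm0⟩ hle⟩

/-- The random Hahn–Banach theorem: a minimal `L⁰`-sublinear map is `L⁰`-linear, as minimality can
be applied to `x ↦ ⋀ {p (x + t • y) - t * p y : t ≥ 0}`. -/
theorem IsL0Sublinear.exists_linearMap_le [IsProbabilityMeasure μ] {p₀ : E → L0 μ}
    (hp₀ : IsL0Sublinear p₀) : ∃ g : E →ₗ[L0 μ] L0 μ, ∀ x, g x ≤ p₀ x := by
  obtain ⟨p, hp, hpp₀, hmin⟩ := hp₀.exists_minimal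
  have hadd : ∀ x y, p (x + y) = p x + p y := by
    intro x y
    refine le_antisymm (hp.add_le x y) ?_
    obtain ⟨q, hq, hglb⟩ := exists_isL0Sublinear_isGLB
      (fun x => {a | ∃ t : L0 μ, 0 ≤ t ∧ a = p (x + t • y) - t * p y})
      (fun x => ⟨_, 0, le_rfl, rfl⟩)
      (fun x => ⟨-p (-x), by
        rintro _ ⟨t, ht, rfl⟩
        have h1 := hp.add_le (x + t • y) (-x)
        rw [add_neg_cancel_comm] at h1
        rw [le_sub_iff_add_le, neg_add_le_iff_le_add, add_comm]
        exact (hp.mul_le_smul ht y).trans h1⟩)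
      (by
        rintro x x' _ ⟨t, ht, rfl⟩ _ ⟨t', ht', rfl⟩
        refine ⟨_, ⟨t + t', add_nonneg ht ht', rfl⟩, ?_⟩
        have h1 := hp.add_le (x + t • y) (x' + t' • y)
        rw [show x + t • y + (x' + t' • y) = x + x' + (t + t') • y by rw [add_smul]; abel] at h1
        calc _ ≤ p (x + t • y) + p (x' + t' • y) - (t + t') * p y := sub_le_sub_right h1 _
          _ = _ := by ring)
      (by
        rintro ξ x hξ _ ⟨t, ht, rfl⟩
        refine ⟨_, ⟨ξ * t, mul_nonneg hξ ht, rfl⟩, ?_⟩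
        rw [mul_smul, ← smul_add, mul_sub, mul_assoc]
        exact sub_le_sub_right (hp.smul_le ξ _ hξ) _)
    have hqp : q ≤ p := fun z => (hglb z).1 ⟨0, le_rfl, by simp⟩
    have h1 : p x ≤ p (x + y) - p y :=
      (hmin q hq hqp x).trans ((hglb x).1 ⟨1, zero_le_one, by simp⟩)
    exact le_sub_iff_add_le.1 h1
  have hsmul : ∀ (ξ : L0 μ) x, 0 ≤ ξ → p (ξ • x) = ξ * p x := fun ξ x hξ =>
    le_antisymm (hp.smul_le ξ x hξ) (hp.mul_le_smul hξ x)
  have hneg : ∀ x, p (-x) = -p x := fun x => by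
    have h := hadd (-x) x
    rw [neg_add_cancel, hp.zero] at h
    exact eq_neg_of_add_eq_zero_left h.symm
  refine ⟨{ toFun := p, map_add' := hadd, map_smul' := fun ξ x => ?_ }, hpp₀⟩
  have h : ξ • x = ξ⁺ • x + -(ξ⁻ • x) := by
    rw [← sub_eq_add_neg, ← sub_smul, posPart_sub_negPart]
  rw [h, hadd, hneg, hsmul _ _ (posPart_nonneg ξ), hsmul _ _ (negPart_nonneg ξ), ← sub_eq_add_neg,
    ← sub_mul, posPart_sub_negPart]
  rfl

theorem IsL0Seminorm.zero {q : E → L0 μ} (hq : IsL0Seminorm q) : q 0 = 0 := by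
  simpa using hq.smul 0 0

theorem IsL0Seminorm.neg {q : E → L0 μ} (hq : IsL0Seminorm q) (x : E) : q (-x) = q x := by
  have := hq.smul (-1) x
  rwa [neg_smul, one_smul, abs_neg, abs_of_nonneg zero_le_one, one_mul] at this

/-- Sandwich theorem: if an `L⁰`-convex set `C ⊆ E × L⁰` lies above `-q`, then some `L⁰`-linear
`g ≤ q` lies below `C`. The map `g` comes from the sublinear
`z ↦ ⋀ {q (z - t • y) + t * r : t ≥ 0, (y, r) ∈ C}`. -/
theorem IsL0Seminorm.exists_linearMap_le_of_convex [IsProbabilityMeasure μ] {q : E → L0 μ}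
    (hq : IsL0Seminorm q) {C : Set (E × L0 μ)} (hne : C.Nonempty)
    (hC : ∀ a ∈ C, ∀ b ∈ C, ∀ ξ : L0 μ, 0 ≤ ξ → ξ ≤ 1 → ξ • a + (1 - ξ) • b ∈ C)
    (hqC : ∀ a ∈ C, -q a.1 ≤ a.2) :
    ∃ g : E →ₗ[L0 μ] L0 μ, (∀ x, g x ≤ q x) ∧ ∀ a ∈ C, g a.1 ≤ a.2 := by
  obtain ⟨c₀, hc₀⟩ := hne
  obtain ⟨p, hp, hglb⟩ := exists_isL0Sublinear_isGLB
    (fun z => {s | ∃ t : L0 μ, 0 ≤ t ∧ ∃ a ∈ C, s = q (z - t • a.1) + t * a.2})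
    (fun z => ⟨_, 0, le_rfl, c₀, hc₀, rfl⟩)
    (fun z => ⟨-q z, by
      rintro _ ⟨t, ht, a, ha, rfl⟩
      have h1 : q (t • a.1) ≤ q (z - t • a.1) + q z := by
        have := hq.add_le (-(z - t • a.1)) z
        rwa [hq.neg, neg_sub, sub_add_cancel] at this
      have h2 : -q (t • a.1) ≤ t * a.2 := by
        rw [hq.smul, abs_of_nonneg ht, ← mul_neg]
        exact mul_le_mul_of_nonneg_left (hqC a ha) ht
      calc -q z ≤ q (z - t • a.1) - q (t • a.1) := by
            rw [neg_le_sub_iff_le_add]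
            exact h1
        _ ≤ _ := by
            rw [sub_eq_add_neg]
            exact add_le_add_right h2 _⟩)
    (by
      rintro x x' _ ⟨t, ht, a, ha, rfl⟩ _ ⟨t', ht', a', ha', rfl⟩
      obtain ⟨ξ, h0, h1, hξ⟩ := L0.exists_weight ht ht'
      have hξ' : (t + t') * (1 - ξ) = t' := by rw [mul_sub, hξ]; ring
      refine ⟨_, ⟨t + t', add_nonneg ht ht', _, hC a ha a' ha' ξ h0 h1, rfl⟩, ?_⟩
      have e1 : x + x' - (t + t') • (ξ • a + (1 - ξ) • a').1 =
          (x - t • a.1) + (x' - t' • a'.1) := by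
        simp only [Prod.fst_add, Prod.smul_fst, smul_add, smul_smul, hξ, hξ']
        abel
      have e2 : (t + t') * (ξ • a + (1 - ξ) • a').2 = t * a.2 + t' * a'.2 := by
        simp only [Prod.snd_add, Prod.smul_snd, smul_eq_mul, mul_add, ← mul_assoc, hξ, hξ']
      rw [e1, e2]
      calc _ ≤ q (x - t • a.1) + q (x' - t' • a'.1) + (t * a.2 + t' * a'.2) :=
            add_le_add_left (hq.add_le _ _) _
        _ = _ := by ring)
    (by
      rintro ξ x hξ _ ⟨t, ht, a, ha, rfl⟩
      refine ⟨_, ⟨ξ * t, mul_nonneg hξ ht, a, ha, rfl⟩, ?_⟩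
      rw [mul_smul, ← smul_sub, hq.smul, abs_of_nonneg hξ, mul_add, mul_assoc])
  obtain ⟨g, hg⟩ := hp.exists_linearMap_le
  refine ⟨g, fun x => (hg x).trans ((hglb x).1 ⟨0, le_rfl, c₀, hc₀, by simp⟩), fun a ha =>
    (hg a.1).trans ((hglb a.1).1 ⟨1, zero_le_one, a, ha, by simp [hq.zero]⟩)⟩

end HahnBanach

/-! ### Locality and concatenation -/

section Locality

variable {A : Set Ω}

theorem coe_ind (hA : MeasurableSet A) :
    ∀ᵐ ω ∂μ, (ω ∈ A → ind A hA (μ := μ) ω = 1) ∧ (ω ∉ A → ind A hA (μ := μ) ω = 0) := by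
  have h : ind A hA =ᵐ[μ] A.indicator fun _ => (1 : ℝ) := AEEqFun.coeFn_mk _ _
  filter_upwards [h] with ω h
  exact ⟨fun hω => by rw [h, indicator_of_mem hω], fun hω => by rw [h, indicator_of_notMem hω]⟩

theorem ind_nonneg (hA : MeasurableSet A) : (0 : L0 μ) ≤ ind A hA := by
  rw [L0.nonneg_iff]
  filter_upwards [coe_ind (μ := μ) hA] with ω h
  by_cases hω : ω ∈ A
  · simp [h.1 hω]
  · simp [h.2 hω]

theorem ind_le_one (hA : MeasurableSet A) : (ind A hA : L0 μ) ≤ 1 := by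
  rw [L0.le_iff]
  filter_upwards [coe_ind (μ := μ) hA, L0.coe_one (μ := μ)] with ω h h1
  by_cases hω : ω ∈ A
  · simp [h.1 hω, h1]
  · simp [h.2 hω, h1]

theorem ind_mul_self (hA : MeasurableSet A) : (ind A hA * ind A hA : L0 μ) = ind A hA := by
  refine AEEqFun.ext ?_
  filter_upwards [coe_ind (μ := μ) hA, L0.coe_mul (ind A hA : L0 μ) (ind A hA)] with ω h h1
  by_cases hω : ω ∈ A
  · simp [h.1 hω, h1]
  · simp [h.2 hω, h1]

theorem ind_compl (hA : MeasurableSet A) : (ind Aᶜ hA.compl : L0 μ) = 1 - ind A hA := by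
  refine AEEqFun.ext ?_
  filter_upwards [coe_ind (μ := μ) hA, coe_ind (μ := μ) hA.compl, L0.coe_one (μ := μ),
    L0.coe_sub (1 : L0 μ) (ind A hA)] with ω h h1 h2 h3
  by_cases hω : ω ∈ A
  · simp [h.1 hω, h1.2 (not_not.2 hω), h2, h3]
  · simp [h.2 hω, h1.1 hω, h2, h3]

theorem eq_on_of_ind_mul_eq (hA : MeasurableSet A) {a b : L0 μ}
    (h : ind A hA * a = ind A hA * b) : ∀ᵐ ω ∂μ, ω ∈ A → a ω = b ω := by
  filter_upwards [coe_ind (μ := μ) hA, L0.coe_mul (ind A hA) a, L0.coe_mul (ind A hA) b]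
    with ω h1 h2 h3 hω
  rw [h, h3, h1.1 hω, one_mul, one_mul] at h2
  exact h2.symm

variable {E : Type v} [AddCommGroup E] [Module (L0 μ) E]

/-- The element which is `x` on `A` and `y` off `A`. -/
noncomputable def patch (A : Set Ω) (hA : MeasurableSet A) (x y : E) : E :=
  (ind A hA : L0 μ) • x + (1 - ind A hA : L0 μ) • y

theorem ind_smul_patch (hA : MeasurableSet A) (x y : E) :
    (ind A hA : L0 μ) • patch (μ := μ) A hA x y = (ind A hA : L0 μ) • x := by
  rw [patch, smul_add, smul_smul, smul_smul, mul_sub, ind_mul_self, mul_one, sub_self, zero_smul,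
    add_zero]

theorem ind_compl_smul_patch (hA : MeasurableSet A) (x y : E) :
    (ind Aᶜ hA.compl : L0 μ) • patch (μ := μ) A hA x y = (ind Aᶜ hA.compl : L0 μ) • y := by
  rw [ind_compl, patch, smul_add, smul_smul, smul_smul, sub_mul, one_mul, ind_mul_self, sub_self,
    zero_smul, zero_add, mul_sub, mul_one, sub_mul, one_mul, ind_mul_self, sub_self, sub_zero]
  exact hA

theorem IsL0Seminorm.eq_on {q : E → L0 μ} (hq : IsL0Seminorm q) (hA : MeasurableSet A) {x y : E}
    (h : (ind A hA : L0 μ) • x = (ind A hA : L0 μ) • y) : ∀ᵐ ω ∂μ, ω ∈ A → q x ω = q y ω := by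
  refine eq_on_of_ind_mul_eq hA ?_
  have hx := hq.smul (ind A hA) x
  have hy := hq.smul (ind A hA) y
  rw [abs_of_nonneg (ind_nonneg hA)] at hx hy
  rw [← hx, ← hy, h]

theorem eq_on_of_linearMap (g : E →ₗ[L0 μ] L0 μ) (hA : MeasurableSet A) {x y : E}
    (h : (ind A hA : L0 μ) • x = (ind A hA : L0 μ) • y) : ∀ᵐ ω ∂μ, ω ∈ A → g x ω = g y ω := by
  refine eq_on_of_ind_mul_eq hA ?_
  rw [← smul_eq_mul, ← smul_eq_mul, ← map_smul, ← map_smul, h]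

/-- An `L⁰`-convex function is local: on `A`, the value `f x` depends on `x` on `A` only. -/
theorem IsL0Convex.eq_on {f : E → L0bar μ} (hf : IsL0Convex f) (hA : MeasurableSet A) {x y : E}
    (h : (ind A hA : L0 μ) • x = (ind A hA : L0 μ) • y) : ∀ᵐ ω ∂μ, ω ∈ A → f x ω = f y ω := by
  have key : ∀ x y : E, (ind A hA : L0 μ) • x = (ind A hA : L0 μ) • y →
      ∀ᵐ ω ∂μ, ω ∈ A → f x ω ≤ f y ω := by
    intro x y h
    have hx : x = (ind A hA : L0 μ) • y + (1 - ind A hA : L0 μ) • x := by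
      rw [← h, sub_smul, one_smul, add_sub_cancel]
    filter_upwards [hf y x (ind A hA) (ind_nonneg hA) (ind_le_one hA), coe_ind (μ := μ) hA]
      with ω h1 h2 hω
    rw [← hx, h2.1 hω] at h1
    simpa using h1
  filter_upwards [key x y h, key y x h.symm] with ω h1 h2 hω
  exact le_antisymm (h1 hω) (h2 hω)

/-- Concatenation along sets `B n` that need not be disjoint nor cover `Ω`: on each piece `G n` of a
partition of `Ω` the new element is `z n`, and on `⋃ n, B n` the piece `G n` lies inside `B n`. -/
theorem HasCountableConcatenation.exists_concat (hE : HasCountableConcatenation μ E)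
    {B : ℕ → Set Ω} (hB : ∀ n, MeasurableSet (B n)) (z : ℕ → E) :
    ∃ (y : E) (G : ℕ → Set Ω) (hG : ∀ n, MeasurableSet (G n)), (∀ ω, ∃ n, ω ∈ G n) ∧
      (∀ n, ∀ ω ∈ G n, ∀ m, ω ∈ B m → ω ∈ B n) ∧
      ∀ n, (ind (G n) (hG n) : L0 μ) • y = (ind (G n) (hG n) : L0 μ) • z n := by
  let B' : ℕ → Set Ω := fun n => B n ∪ (⋃ m, B m)ᶜ
  have hB' : ∀ n, MeasurableSet (B' n) := fun n => (hB n).union (MeasurableSet.iUnion hB).compl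
  have hU : ⋃ n, disjointed B' n = univ := by
    rw [iUnion_disjointed, eq_univ_iff_forall]
    intro ω
    by_cases h : ω ∈ ⋃ m, B m
    · obtain ⟨m, hm⟩ := mem_iUnion.1 h
      exact mem_iUnion.2 ⟨m, Or.inl hm⟩
    · exact mem_iUnion.2 ⟨0, Or.inr h⟩
  have hG : ∀ n, MeasurableSet (disjointed B' n) := fun n => MeasurableSet.disjointed hB' n
  obtain ⟨y, hy⟩ := hE (disjointed B') hG (disjoint_disjointed B') hU z
  refine ⟨y, disjointed B', hG, fun ω => mem_iUnion.1 (hU ▸ mem_univ ω), fun n ω hω m hm => ?_, hy⟩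
  rcases disjointed_subset B' n hω with h | h
  · exact h
  · exact absurd (mem_iUnion.2 ⟨m, hm⟩) h

/-- Among the `z` in an `L⁰`-ball, one makes the set `{f (x + z) ≤ s}` largest up to null sets. The
concatenation property turns a maximizing sequence into a maximizer. -/
theorem exists_maximal_sublevel [IsProbabilityMeasure μ] (hE : HasCountableConcatenation μ E)
    {f : E → L0bar μ} (hf : IsL0Convex f) {q : E → L0 μ} (hq : IsL0Seminorm q) {ε : L0 μ}
    (hε : 0 ≤ ε) (x : E) (s : L0 μ) :
    ∃ z, q z ≤ ε ∧ ∀ z', q z' ≤ ε →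
      ∀ᵐ ω ∂μ, f (x + z') ω ≤ (s ω : EReal) → f (x + z) ω ≤ (s ω : EReal) := by
  let T : E → Set Ω := fun z => {ω | f (x + z) ω ≤ (s ω : EReal)}
  have hT : ∀ z, MeasurableSet (T z) := fun z =>
    measurableSet_le (f (x + z)).measurable (measurable_coe_real_ereal.comp s.measurable)
  have hloc : ∀ {A : Set Ω} (hA : MeasurableSet A) {y z : E},
      (ind A hA : L0 μ) • y = (ind A hA : L0 μ) • z →
      ∀ᵐ ω ∂μ, ω ∈ A → f (x + y) ω = f (x + z) ω := fun hA _ _ h =>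
    hf.eq_on hA (by rw [smul_add, smul_add, h])
  obtain ⟨a, -, ha, haS⟩ := exists_seq_tendsto_sSup (S := (fun z => μ (T z)) '' {z | q z ≤ ε})
    ⟨_, 0, (hq.zero.trans_le hε :), rfl⟩ (OrderTop.bddAbove _)
  choose w hw hwa using haS
  obtain ⟨z, G, hG, hcov, hGB, hz⟩ := hE.exists_concat (fun n => hT (w n)) w
  have hzε : q z ≤ ε := by
    rw [L0.le_iff]
    filter_upwards [ae_all_iff.2 fun n => hq.eq_on (hG n) (hz n),
      ae_all_iff.2 fun n => L0.le_iff.1 (hw n)] with ω h1 h2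
    obtain ⟨n, hn⟩ := hcov ω
    rw [h1 n hn]
    exact h2 n
  have hsub : ∀ m, T (w m) ≤ᵐ[μ] T z := by
    intro m
    filter_upwards [ae_all_iff.2 fun n => hloc (hG n) (hz n)] with ω h1 hω
    obtain ⟨n, hn⟩ := hcov ω
    change f (x + z) ω ≤ _
    rw [h1 n hn]
    exact hGB n ω hn m hω
  have hmax : ∀ z', q z' ≤ ε → μ (T z') ≤ μ (T z) := fun z' hz' =>
    (le_sSup (mem_image_of_mem (fun z => μ (T z)) hz')).trans
      (le_of_tendsto' ha fun m => (hwa m).symm.trans_le (measure_mono_ae (hsub m)))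
  refine ⟨z, hzε, fun z' hz' => ?_⟩
  have e1 := ind_smul_patch (μ := μ) (hT z') z' z
  have e2 := ind_compl_smul_patch (μ := μ) (hT z') z' z
  set y := patch (μ := μ) (T z') (hT z') z' z
  have hyε : q y ≤ ε := by
    rw [L0.le_iff]
    filter_upwards [hq.eq_on _ e1, hq.eq_on _ e2, L0.le_iff.1 hz', L0.le_iff.1 hzε]
      with ω h1 h2 h3 h4
    by_cases hω : ω ∈ T z'
    · rwa [h1 hω]
    · rwa [h2 hω]
  have hzy : T z ≤ᵐ[μ] T y := by
    filter_upwards [hloc _ e1, hloc _ e2] with ω h1 h2 h3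
    change f (x + y) ω ≤ _
    by_cases hω : ω ∈ T z'
    · rw [h1 hω]
      exact hω
    · rw [h2 hω]
      exact h3
  have heq := ae_eq_of_ae_subset_of_measure_ge hzy (hmax y hyε) (hT z).nullMeasurableSet
    (measure_ne_top μ _)
  filter_upwards [hloc _ e1, heq.mem_iff] with ω h1 h2 hω
  refine h2.2 ?_
  change f (x + y) ω ≤ _
  rw [h1 hω]
  exact hω

end Locality

/-! ### Continuous seminorms and the random conjugate space -/

section Conjugate

/-- A random variable is dominated by a nonnegative multiple of any strictly positive one. -/
theorem exists_bound (a : L0 μ) {ε : L0 μ} (hε : IsStrictlyPos ε) :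
    ∃ K : L0 μ, 0 ≤ K ∧ ∀ᵐ ω ∂μ, |a ω| ≤ K ω * ε ω := by
  obtain ⟨K, hK⟩ := L0.exists_coe_eq (μ := μ) (φ := fun ω => |a ω| / ε ω)
    ((continuous_abs.measurable.comp a.measurable).div ε.measurable)
  refine ⟨K, L0.nonneg_iff.2 ?_, ?_⟩
  · filter_upwards [hK, hε] with ω h1 h2
    rw [h1]
    positivity
  · filter_upwards [hK, hε] with ω h1 h2
    rw [h1, div_mul_cancel₀ _ h2.ne']

variable {E : Type v} [AddCommGroup E] [Module (L0 μ) E] {P : Set (E → L0 μ)}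

/-- `L⁰`-seminorms that are `𝒯_c`-continuous at the origin. -/
structure IsContinuousL0Seminorm (P : Set (E → L0 μ)) (q : E → L0 μ) : Prop where
  seminorm : IsL0Seminorm q
  small : ∀ ε : L0 μ, IsStrictlyPos ε → ∃ Q : Set (E → L0 μ), Q ⊆ P ∧ Q.Finite ∧
    ∃ δ : L0 μ, IsStrictlyPos δ ∧ ∀ z : E, (∀ p ∈ Q, p z ≤ δ) → q z ≤ ε

theorem IsStrictlyPos.nonneg {ε : L0 μ} (hε : IsStrictlyPos ε) : 0 ≤ ε :=
  L0.nonneg_iff.2 (by filter_upwards [hε] with ω h using h.le)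

namespace IsContinuousL0Seminorm

theorem of_mem (hP : IsRLCModule P) {p : E → L0 μ} (hp : p ∈ P) : IsContinuousL0Seminorm P p :=
  ⟨hP.seminorm p hp, fun ε hε =>
    ⟨{p}, singleton_subset_iff.2 hp, finite_singleton p, ε, hε, fun _ hz => hz p rfl⟩⟩

theorem zero : IsContinuousL0Seminorm P (fun _ : E => (0 : L0 μ)) :=
  ⟨⟨fun _ => le_rfl, fun _ _ => (mul_zero _).symm, fun _ _ => (add_zero _).ge⟩, fun ε hε =>
    ⟨∅, empty_subset _, finite_empty, ε, hε, fun _ _ => hε.nonneg⟩⟩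

theorem const_mul {q : E → L0 μ} (hq : IsContinuousL0Seminorm P q) {K : L0 μ} (hK : 0 ≤ K) :
    IsContinuousL0Seminorm P (fun z => K * q z) := by
  refine ⟨⟨fun z => mul_nonneg hK (hq.1.nonneg z), fun ξ z => ?_, fun y z => ?_⟩, fun ε hε => ?_⟩
  · rw [hq.1.smul, mul_left_comm]
  · rw [← mul_add]
    exact mul_le_mul_of_nonneg_left (hq.1.add_le y z) hK
  · obtain ⟨δ, hδ, hδε⟩ := L0.exists_mul_one_add_eq hε hK
    obtain ⟨Q, hQP, hQf, η, hη, hQ⟩ := hq.2 δ hδ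
    refine ⟨Q, hQP, hQf, η, hη, fun z hz => ?_⟩
    calc K * q z ≤ (1 + K) * q z :=
          mul_le_mul_of_nonneg_right (le_add_of_nonneg_left zero_le_one) (hq.1.nonneg z)
      _ ≤ (1 + K) * δ := mul_le_mul_of_nonneg_left (hQ z hz) (add_nonneg zero_le_one hK)
      _ = ε := by rw [mul_comm, hδε]

theorem add {q q' : E → L0 μ} (hq : IsContinuousL0Seminorm P q)
    (hq' : IsContinuousL0Seminorm P q') : IsContinuousL0Seminorm P (fun z => q z + q' z) := by
  refine ⟨⟨fun z => add_nonneg (hq.1.nonneg z) (hq'.1.nonneg z), fun ξ z => ?_, fun y z => ?_⟩,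
    fun ε hε => ?_⟩
  · rw [hq.1.smul, hq'.1.smul, mul_add]
  · rw [add_add_add_comm]
    exact add_le_add (hq.1.add_le y z) (hq'.1.add_le y z)
  · -- `δ * (1 + 1) = ε`
    obtain ⟨δ, hδ, hδε⟩ := L0.exists_mul_one_add_eq hε (zero_le_one (α := L0 μ))
    obtain ⟨Q, hQP, hQf, η, hη, hQ⟩ := hq.2 δ hδ
    obtain ⟨Q', hQP', hQf', η', hη', hQ'⟩ := hq'.2 δ hδ
    refine ⟨Q ∪ Q', union_subset hQP hQP', hQf.union hQf', η ⊓ η', ?_, fun z hz => ?_⟩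
    · filter_upwards [hη, hη', AEEqFun.coeFn_inf η η'] with ω h1 h2 h3
      rw [h3]
      exact lt_inf_iff.2 ⟨h1, h2⟩
    · rw [← hδε, mul_add, mul_one]
      exact add_le_add (hQ z fun p hp => (hz p (Or.inl hp)).trans inf_le_left)
        (hQ' z fun p hp => (hz p (Or.inr hp)).trans inf_le_right)

theorem exists_ge (hP : IsRLCModule P) {Q : Set (E → L0 μ)} (hQ : Q.Finite) (hQP : Q ⊆ P) :
    ∃ q, IsContinuousL0Seminorm P q ∧ ∀ p ∈ Q, ∀ z, p z ≤ q z := by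
  induction Q, hQ using Set.Finite.induction_on with
  | empty => exact ⟨_, zero, by simp⟩
  | @insert p Q _ _ ih =>
    obtain ⟨q, hq, hle⟩ := ih ((subset_insert p Q).trans hQP)
    have hp := of_mem hP (hQP (mem_insert p Q))
    refine ⟨_, hp.add hq, ?_⟩
    rintro p' (rfl | hp') z
    · exact le_add_of_nonneg_right (hq.1.nonneg z)
    · exact (hle p' hp' z).trans (le_add_of_nonneg_left (hp.1.nonneg z))

theorem mem_dualC {q : E → L0 μ} (hq : IsContinuousL0Seminorm P q) {g : E →ₗ[L0 μ] L0 μ}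
    (hg : ∀ z, g z ≤ q z) : g ∈ dualC P := by
  have habs : ∀ z, |g z| ≤ q z := fun z => abs_le'.2 ⟨hg z, by
    rw [← map_neg, ← hq.1.neg z]
    exact hg (-z)⟩
  refine @continuous_def _ _ (topC P) (topL0 μ) g |>.2 fun U hU x hx => ?_
  obtain ⟨R, hR, -, ε, hε, hRU⟩ := hU (g x) hx
  obtain ⟨Q, hQP, hQf, δ, hδ, hQ⟩ := hq.2 ε hε
  refine ⟨Q, hQP, hQf, δ, hδ, fun z hz => ?_⟩
  rw [mem_preimage, map_add]
  refine hRU _ fun p hp => ?_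
  rw [mem_singleton_iff.1 (hR hp)]
  exact (habs z).trans (hQ z hz)

end IsContinuousL0Seminorm

/-! ### Affine minorants -/

variable {f : E → L0bar μ}

/-- Lower semicontinuity, in local form: where `f x > c`, the bound persists on a neighbourhood of
`x`, after shrinking to a smaller set `D` of positive probability. Here `𝒯_c`-closedness
alone yields `f (x + z) > c` only on a set depending on `z`; the set `D` is the complement of the
largest possible set `{f (x + z) ≤ c}`. -/
theorem exists_lt_on_ball [IsProbabilityMeasure μ] (hP : IsRLCModule P)
    (hE : HasCountableConcatenation μ E) (hproper : IsProper f) (hlsc : IsLscC P f)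
    (hconv : IsL0Convex f) {A : Set Ω} (hA : MeasurableSet A) (hμA : μ A ≠ 0) (x : E) (c : ℝ)
    (hc : ∀ ω ∈ A, (c : EReal) < f x ω) :
    ∃ D ⊆ A, MeasurableSet D ∧ μ D ≠ 0 ∧ ∃ q, IsContinuousL0Seminorm P q ∧ ∃ ε : L0 μ,
      IsStrictlyPos ε ∧ ∀ z, q z ≤ ε → ∀ᵐ ω ∂μ, ω ∈ D → (c : EReal) < f (x + z) ω := by
  classical
  obtain ⟨x₀, hx₀⟩ := hproper.1
  -- Off `A`, replace `x` by `x₀` and `c` by `f x₀`, so that `f x' ≤ s` holds exactly off `A`.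
  obtain ⟨s, hs⟩ := L0.exists_coe_eq (μ := μ) (φ := fun ω => if ω ∈ A then c else (f x₀ ω).toReal)
    (Measurable.ite hA measurable_const (measurable_ereal_toReal.comp (f x₀).measurable))
  have e1 := ind_smul_patch (μ := μ) hA x x₀
  have e2 := ind_compl_smul_patch (μ := μ) hA x x₀
  set x' := patch (μ := μ) A hA x x₀
  have hx' : x' ∈ {y | f y ≤ toBar s}ᶜ := by
    intro h
    refine hμA (measure_eq_zero_iff_ae_notMem.2 ?_)
    filter_upwards [AEEqFun.coeFn_le.2 h, L0.coe_toBar s, hs, hconv.eq_on hA e1]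
      with ω h1 h2 h3 h4 hω
    rw [h2, h3, if_pos hω, h4 hω] at h1
    exact (hc ω hω).not_ge h1
  obtain ⟨Q, hQP, hQf, ε, hε, hQ⟩ := (hlsc s).1 x' hx'
  obtain ⟨q, hq, hle⟩ := IsContinuousL0Seminorm.exists_ge hP hQf hQP
  obtain ⟨z₀, hz₀, hmax⟩ := exists_maximal_sublevel hE hconv hq.1 hε.nonneg x' s
  have hT : MeasurableSet {ω | (s ω : EReal) < f (x' + z₀) ω} :=
    measurableSet_lt (measurable_coe_real_ereal.comp s.measurable) (f (x' + z₀)).measurable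
  have hTA : ∀ᵐ ω ∂μ, (s ω : EReal) < f (x' + z₀) ω → ω ∈ A := by
    filter_upwards [hmax 0 (hq.1.zero.trans_le hε.nonneg), hs, hx₀, hconv.eq_on hA.compl e2]
      with ω h1 h2 h3 h4 h5
    by_contra hω
    refine h5.not_ge (h1 ?_)
    rw [add_zero, h4 hω, h2, if_neg hω, EReal.coe_toReal h3.2 h3.1]
  refine ⟨A ∩ {ω | (s ω : EReal) < f (x' + z₀) ω}, inter_subset_left, hA.inter hT, fun h0 => ?_,
    q, hq, ε, hε, fun z hz => ?_⟩
  · refine hQ z₀ (fun p hp => (hle p hp z₀).trans hz₀) ?_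
    change f (x' + z₀) ≤ toBar s
    rw [← AEEqFun.coeFn_le]
    filter_upwards [measure_eq_zero_iff_ae_notMem.1 h0, hTA, L0.coe_toBar s] with ω h1 h2 h3
    rw [h3]
    by_contra h
    exact h1 ⟨h2 (not_le.1 h), not_le.1 h⟩
  · have e3 : (ind A hA : L0 μ) • (x' + z) = (ind A hA : L0 μ) • (x + z) := by
      rw [smul_add, smul_add, e1]
    filter_upwards [hmax z hz, hs, hconv.eq_on hA e3] with ω h1 h2 h3 hω
    rw [h2, if_pos hω.1, h3 hω.1] at h1
    by_contra h
    have h4 : (s ω : EReal) < f (x' + z₀) ω := hω.2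
    rw [h2, if_pos hω.1] at h4
    exact h4.not_ge (h1 (not_lt.1 h))

/-- Near a point `x` with `f x` finite, convexity propagates a lower bound on a ball to a lower bound
by a multiple of a seminorm. -/
theorem IsL0Convex.exists_lower_bound_of_finite (hconv : IsL0Convex f)
    (hbot : ∀ x, ∀ᵐ ω ∂μ, ⊥ < f x ω) {D : Set Ω} {x : E} {r : L0 μ}
    (hr : ∀ᵐ ω ∂μ, f x ω = (r ω : EReal)) {c : ℝ} {q : E → L0 μ}
    (hq : IsContinuousL0Seminorm P q) {ε : L0 μ} (hε : IsStrictlyPos ε)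
    (h : ∀ z, q z ≤ ε → ∀ᵐ ω ∂μ, ω ∈ D → (c : EReal) < f (x + z) ω) :
    ∃ q', IsContinuousL0Seminorm P q' ∧
      ∀ z, ∀ᵐ ω ∂μ, ω ∈ D → ((c - q' z ω : ℝ) : EReal) ≤ f (x + z) ω := by
  obtain ⟨a, ha⟩ := L0.exists_coe_eq (μ := μ) (φ := fun ω => r ω - c)
    (r.measurable.sub measurable_const)
  obtain ⟨K, hK0, hK⟩ := exists_bound a hε
  refine ⟨_, hq.const_mul hK0, fun z => ?_⟩
  -- The point `ξ • z` is the radial projection of `z` to the ball.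
  obtain ⟨ξ, hξ⟩ := L0.exists_coe_eq (μ := μ) (φ := fun ω => ε ω / max (ε ω) (q z ω))
    (ε.measurable.div (ε.measurable.max (q z).measurable))
  have hmax : ∀ᵐ ω ∂μ, 0 < max (ε ω) (q z ω) := by
    filter_upwards [hε] with ω h using lt_max_of_lt_left h
  have hξ0 : 0 ≤ ξ := L0.nonneg_iff.2 (by
    filter_upwards [hξ, hε, hmax] with ω h1 h2 h3
    rw [h1]
    positivity)
  have hξ1 : ξ ≤ 1 := L0.le_iff.2 (by
    filter_upwards [hξ, hmax, L0.coe_one (μ := μ)] with ω h1 h3 h4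
    rw [h1, h4]
    exact div_le_one_of_le₀ (le_max_left _ _) h3.le)
  have hball : q (ξ • z) ≤ ε := by
    rw [hq.1.smul, abs_of_nonneg hξ0, L0.le_iff]
    filter_upwards [hξ, hε, hmax, L0.coe_mul ξ (q z)] with ω h1 h2 h3 h4
    rw [h4, h1, div_mul_eq_mul_div, div_le_iff₀ h3]
    exact mul_le_mul_of_nonneg_left (le_max_right _ _) h2.le
  have hcomb : ξ • (x + z) + (1 - ξ) • x = x + ξ • z := by
    rw [smul_add, sub_smul, one_smul]
    abel
  have hconv' := hconv (x + z) x ξ hξ0 hξ1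
  rw [hcomb] at hconv'
  filter_upwards [hconv', h _ hball, hr, hξ, hε, hK, ha, hbot (x + z), L0.coe_mul K (q z),
    L0.nonneg_iff.1 (hq.1.nonneg z), L0.nonneg_iff.1 hK0] with ω h1 h2 h3 h4 h5 h6 h7 h8 h9 h10 h11 hω
  have h12 := (h2 hω).trans_le h1
  rw [h9]
  rw [h3] at h12
  generalize hv : f (x + z) ω = v at *
  induction v with
  | bot => exact absurd h8 (lt_irrefl _)
  | top => exact le_top
  | coe v =>
    rw [← EReal.coe_mul, ← EReal.coe_mul, ← EReal.coe_add, EReal.coe_lt_coe_iff] at h12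
    rw [EReal.coe_le_coe_iff]
    rw [h7] at h6
    rcases le_total (q z ω) (ε ω) with hle | hle
    · rw [max_eq_left hle, div_self h5.ne'] at h4
      rw [h4] at h12
      have := mul_nonneg h11 h10
      linarith
    · rw [max_eq_right hle] at h4
      have hq0 : 0 < q z ω := h5.trans_le hle
      have e : ξ ω * q z ω = ε ω := by rw [h4, div_mul_cancel₀ _ hq0.ne']
      have h13 : c * q z ω < ε ω * v + (q z ω - ε ω) * r ω := by
        have := mul_lt_mul_of_pos_right h12 hq0
        calc _ < _ := this
          _ = _ := by rw [← e]; ring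
      have h14 : (q z ω - ε ω) * (r ω - c) ≤ q z ω * (K ω * ε ω) :=
        calc _ ≤ (q z ω - ε ω) * |r ω - c| :=
              mul_le_mul_of_nonneg_left (le_abs_self _) (sub_nonneg.2 hle)
          _ ≤ q z ω * |r ω - c| := mul_le_mul_of_nonneg_right (by linarith) (abs_nonneg _)
          _ ≤ _ := mul_le_mul_of_nonneg_left h6 h10
      refine le_of_mul_le_mul_left ?_ h5
      nlinarith

/-- Given some lower bound by a seminorm, the constant in it can be improved to any `c` that bounds
`f` from below on a ball. -/
theorem IsL0Convex.exists_lower_bound_of_ball (hconv : IsL0Convex f) {D : Set Ω} {x : E} {c : ℝ}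
    {q : E → L0 μ} (hq : IsContinuousL0Seminorm P q) {ε : L0 μ} (hε : IsStrictlyPos ε)
    (h : ∀ z, q z ≤ ε → ∀ᵐ ω ∂μ, ω ∈ D → (c : EReal) < f (x + z) ω) {b : L0 μ} {q' : E → L0 μ}
    (hq' : IsContinuousL0Seminorm P q')
    (hb : ∀ z, ∀ᵐ ω ∂μ, ω ∈ D → ((b ω - q' z ω : ℝ) : EReal) ≤ f (x + z) ω) :
    ∃ q'', IsContinuousL0Seminorm P q'' ∧
      ∀ z, ∀ᵐ ω ∂μ, ω ∈ D → ((c - q'' z ω : ℝ) : EReal) ≤ f (x + z) ω := by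
  obtain ⟨a, ha⟩ := L0.exists_coe_eq (μ := μ) (φ := fun ω => c - b ω)
    (measurable_const.sub b.measurable)
  obtain ⟨K, hK0, hK⟩ := exists_bound a hε
  refine ⟨_, hq'.add (hq.const_mul hK0), fun z => ?_⟩
  have hB : MeasurableSet {ω | q z ω ≤ ε ω} := measurableSet_le (q z).measurable ε.measurable
  have e1 := ind_smul_patch (μ := μ) hB z 0
  have e2 := ind_compl_smul_patch (μ := μ) hB z 0
  set w := patch (μ := μ) _ hB z 0
  have hw : q w ≤ ε := by
    rw [L0.le_iff]
    filter_upwards [hq.1.eq_on _ e1, hq.1.eq_on _ e2, hε, L0.coe_zero (μ := μ)] with ω h1 h2 h3 h4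
    by_cases hω : q z ω ≤ ε ω
    · rwa [h1 hω]
    · rw [h2 hω, hq.1.zero, h4]
      exact h3.le
  have e3 : (ind _ hB : L0 μ) • (x + w) = (ind _ hB : L0 μ) • (x + z) := by
    rw [smul_add, smul_add, e1]
  filter_upwards [h w hw, hb z, hconv.eq_on hB e3, L0.coe_add (q' z) (K * q z),
    L0.coe_mul K (q z), hK, ha, L0.nonneg_iff.1 (hq'.1.nonneg z), L0.nonneg_iff.1 (hq.1.nonneg z),
    L0.nonneg_iff.1 hK0] with ω h1 h2 h3 h4 h5 h6 h7 h8 h9 h10 hω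
  rw [h4, h5]
  by_cases hle : q z ω ≤ ε ω
  · rw [← h3 hle]
    refine le_trans ?_ (h1 hω).le
    rw [EReal.coe_le_coe_iff]
    have := mul_nonneg h10 h9
    linarith
  · refine le_trans ?_ (h2 hω)
    rw [EReal.coe_le_coe_iff]
    have := mul_le_mul_of_nonneg_left (not_le.1 hle).le h10
    have := le_abs_self (a ω)
    linarith

/-- A lower bound by a continuous seminorm yields an affine minorant, by the sandwich theorem applied
to the epigraph of `f` on `D`. -/
theorem IsL0Convex.exists_affine_le [IsProbabilityMeasure μ] (hproper : IsProper f)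
    (hconv : IsL0Convex f) {D : Set Ω} (hD : MeasurableSet D) {x : E} {c : ℝ} {q : E → L0 μ}
    (hq : IsContinuousL0Seminorm P q)
    (h : ∀ z, ∀ᵐ ω ∂μ, ω ∈ D → ((c - q z ω : ℝ) : EReal) ≤ f (x + z) ω) :
    ∃ g ∈ dualC P, ∀ z, ∀ᵐ ω ∂μ, ω ∈ D → ((c + g z ω : ℝ) : EReal) ≤ f (x + z) ω := by
  classical
  let C : Set (E × L0 μ) := {a | ∀ᵐ ω ∂μ,
    (ω ∈ D → f (x + a.1) ω ≤ ((a.2 ω + c : ℝ) : EReal)) ∧ (ω ∉ D → 0 ≤ a.2 ω)}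
  obtain ⟨x₀, hx₀⟩ := hproper.1
  have hmem : ∀ y, (∀ᵐ ω ∂μ, f (x + y) ω ≠ ⊤) → ∃ r : L0 μ, (y, r) ∈ C ∧
      ∀ᵐ ω ∂μ, ω ∈ D → ((c + r ω : ℝ) : EReal) = f (x + y) ω := by
    intro y hy
    obtain ⟨r, hr⟩ := L0.exists_coe_eq (μ := μ)
      (φ := fun ω => if ω ∈ D then (f (x + y) ω).toReal - c else 0)
      (Measurable.ite hD ((measurable_ereal_toReal.comp (f (x + y)).measurable).sub
        measurable_const) measurable_const)
    have heq : ∀ᵐ ω ∂μ, ω ∈ D → ((c + r ω : ℝ) : EReal) = f (x + y) ω := by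
      filter_upwards [hr, hy, hproper.2 (x + y)] with ω h1 h2 h3 hω
      rw [h1, if_pos hω, add_sub_cancel, EReal.coe_toReal h2 h3.ne']
    refine ⟨r, ?_, heq⟩
    filter_upwards [heq, hr] with ω h1 h2
    refine ⟨fun hω => ?_, fun hω => ?_⟩
    · rw [← h1 hω, add_comm]
    · rw [h2, if_neg hω]
  have hne : C.Nonempty := by
    obtain ⟨r, hr, -⟩ := hmem (x₀ - x) (by
      rw [add_sub_cancel]
      filter_upwards [hx₀] with ω h using h.2)
    exact ⟨_, hr⟩
  have hCconv : ∀ a ∈ C, ∀ b ∈ C, ∀ ξ : L0 μ, 0 ≤ ξ → ξ ≤ 1 → ξ • a + (1 - ξ) • b ∈ C := by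
    intro a ha b hb ξ h0 h1
    have hcomb : ξ • (x + a.1) + (1 - ξ) • (x + b.1) = x + (ξ • a + (1 - ξ) • b).1 := by
      change _ = x + (ξ • a.1 + (1 - ξ) • b.1)
      simp only [smul_add, sub_smul, one_smul]
      abel
    have hf := hconv (x + a.1) (x + b.1) ξ h0 h1
    rw [hcomb] at hf
    filter_upwards [hf, ha, hb, L0.nonneg_iff.1 h0, L0.le_iff.1 h1, L0.coe_one (μ := μ),
      L0.coe_sub 1 ξ, L0.coe_mul ξ a.2, L0.coe_mul (1 - ξ) b.2,
      L0.coe_add (ξ * a.2) ((1 - ξ) * b.2)] with ω k1 k2 k3 k4 k5 k6 k7 k8 k9 k10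
    rw [k6] at k5 k7
    have e : (ξ • a + (1 - ξ) • b).2 ω = ξ ω * a.2 ω + (1 - ξ ω) * b.2 ω := by
      rw [← k7, ← k9, ← k8, ← k10]
      rfl
    have k5' : 0 ≤ 1 - ξ ω := sub_nonneg.2 k5
    rw [e]
    refine ⟨fun hω => k1.trans ?_, fun hω => ?_⟩
    · calc _ ≤ ((ξ ω : ℝ) : EReal) * ((a.2 ω + c : ℝ) : EReal) +
            ((1 - ξ ω : ℝ) : EReal) * ((b.2 ω + c : ℝ) : EReal) :=
            add_le_add (mul_le_mul_of_nonneg_left (k2.1 hω) (EReal.coe_nonneg.2 k4))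
              (mul_le_mul_of_nonneg_left (k3.1 hω) (EReal.coe_nonneg.2 k5'))
        _ = _ := by
            rw [← EReal.coe_mul, ← EReal.coe_mul, ← EReal.coe_add]
            congr 1
            ring
    · exact add_nonneg (mul_nonneg k4 (k2.2 hω)) (mul_nonneg k5' (k3.2 hω))
  have hqC : ∀ a ∈ C, -q a.1 ≤ a.2 := by
    intro a ha
    rw [L0.le_iff]
    filter_upwards [ha, h a.1, L0.coe_neg (q a.1), L0.nonneg_iff.1 (hq.1.nonneg a.1)]
      with ω k1 k2 k3 k4
    rw [k3]
    by_cases hω : ω ∈ D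
    · have := EReal.coe_le_coe_iff.1 ((k2 hω).trans (k1.1 hω))
      linarith
    · have := k1.2 hω
      linarith
  obtain ⟨g, hgq, hgC⟩ := hq.1.exists_linearMap_le_of_convex hne hCconv hqC
  refine ⟨g, hq.mem_dualC hgq, fun z => ?_⟩
  -- Where `f (x + z) = ∞` nothing is claimed, so `x + z` may be replaced by `x₀` there.
  have hB : MeasurableSet {ω | f (x + z) ω ≠ ⊤} :=
    (f (x + z)).measurable (measurableSet_singleton ⊤).compl
  have e1 := ind_smul_patch (μ := μ) hB z (x₀ - x)
  have e2 := ind_compl_smul_patch (μ := μ) hB z (x₀ - x)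
  set w := patch (μ := μ) _ hB z (x₀ - x)
  have hloc : ∀ {A : Set Ω} (hA : MeasurableSet A) {y z : E},
      (ind A hA : L0 μ) • y = (ind A hA : L0 μ) • z →
      ∀ᵐ ω ∂μ, ω ∈ A → f (x + y) ω = f (x + z) ω := fun hA _ _ h =>
    hconv.eq_on hA (by rw [smul_add, smul_add, h])
  have e3 := hloc _ e1
  obtain ⟨r, hr, hrf⟩ := hmem w (by
    filter_upwards [e3, hloc _ e2, hx₀] with ω k1 k2 k3
    by_cases hω : f (x + z) ω ≠ ⊤
    · rwa [k1 hω]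
    · rw [k2 hω, add_sub_cancel]
      exact k3.2)
  filter_upwards [e3, hrf, L0.le_iff.1 (hgC _ hr), eq_on_of_linearMap g _ e1] with ω k1 k2 k3 k4 hω
  by_cases hz : f (x + z) ω = ⊤
  · rw [hz]
    exact le_top
  · rw [← k1 hz, ← k2 hω, EReal.coe_le_coe_iff, ← k4 hz]
    exact add_le_add_right k3 c

/-! ### The biconjugate -/

theorem coe_subBar (a : L0 μ) (b : L0bar μ) : ∀ᵐ ω ∂μ, subBar a b ω = (a ω : EReal) - b ω :=
  AEEqFun.coeFn_comp₂Measurable _ _ a b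

/-- An affine minorant on `D` bounds the biconjugate on `D`. -/
theorem le_biconjC [IsProbabilityMeasure μ] {D : Set Ω} (hD : MeasurableSet D) {x : E} {c : ℝ}
    (g : dualC P) (h : ∀ z, ∀ᵐ ω ∂μ, ω ∈ D → ((c + g.1 z ω : ℝ) : EReal) ≤ f (x + z) ω) :
    ∀ᵐ ω ∂μ, ω ∈ D → (c : EReal) ≤ biconjC P f x ω := by
  classical
  let φ : Ω → EReal := fun ω => if ω ∈ D then ((g.1 x ω - c : ℝ) : EReal) else ⊤
  have hφ : Measurable φ := Measurable.ite hD
    (measurable_coe_real_ereal.comp ((g.1 x).measurable.sub measurable_const)) measurable_const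
  have hle : conjC P f g ≤ AEEqFun.mk φ hφ.aestronglyMeasurable := by
    refine (isLUB_esup _).2 ?_
    rintro _ ⟨y, rfl⟩
    rw [← AEEqFun.coeFn_le]
    have hz := h (y - x)
    rw [add_sub_cancel, map_sub] at hz
    filter_upwards [coe_subBar (g.1 y) (f y), AEEqFun.coeFn_mk φ hφ.aestronglyMeasurable, hz,
      L0.coe_sub (g.1 y) (g.1 x)] with ω h1 h2 h3 h4
    rw [h1, h2]
    by_cases hω : ω ∈ D
    · simp only [φ, if_pos hω]
      have h5 := h3 hω
      rw [h4] at h5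
      calc (g.1 y ω : EReal) - f y ω ≤ (g.1 y ω : EReal) - ((c + (g.1 y ω - g.1 x ω) : ℝ) : EReal) :=
            EReal.sub_le_sub le_rfl h5
        _ = _ := by
            rw [← EReal.coe_sub]
            congr 1
            ring
    · simp only [φ, if_neg hω]
      exact le_top
  have hge : subBar (g.1 x) (conjC P f g) ≤ biconjC P f x := (isLUB_esup _).1 ⟨g, rfl⟩
  filter_upwards [AEEqFun.coeFn_le.2 hle, AEEqFun.coeFn_le.2 hge, coe_subBar (g.1 x) (conjC P f g),
    AEEqFun.coeFn_mk φ hφ.aestronglyMeasurable] with ω h1 h2 h3 h4 hω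
  rw [h3] at h2
  refine le_trans ?_ h2
  rw [h4] at h1
  simp only [φ, if_pos hω] at h1
  calc (c : EReal) = (g.1 x ω : EReal) - ((g.1 x ω - c : ℝ) : EReal) := by
        rw [← EReal.coe_sub, sub_sub_cancel]
    _ ≤ _ := EReal.sub_le_sub le_rfl h1

theorem biconjC_le [IsProbabilityMeasure μ] (P : Set (E → L0 μ)) (f : E → L0bar μ) (x : E) :
    biconjC P f x ≤ f x := by
  refine (isLUB_esup _).2 ?_
  rintro _ ⟨g, rfl⟩
  have hge : subBar (g.1 x) (f x) ≤ conjC P f g := (isLUB_esup _).1 ⟨x, rfl⟩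
  rw [← AEEqFun.coeFn_le]
  filter_upwards [AEEqFun.coeFn_le.2 hge, coe_subBar (g.1 x) (f x),
    coe_subBar (g.1 x) (conjC P f g)] with ω h1 h2 h3
  rw [h2] at h1
  rw [h3]
  refine (EReal.sub_le_sub le_rfl h1).trans ?_
  generalize f x ω = v
  induction v with
  | bot => simp
  | top => exact le_top
  | coe v => rw [← EReal.coe_sub, ← EReal.coe_sub, sub_sub_cancel]

/-- Measurable selection in the countable set `ℚ`, at the price of a smaller set. -/
theorem exists_rat_measure_ne_zero {A : Set Ω} (hA : μ A ≠ 0) {p : ℚ → Ω → Prop}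
    (h : ∀ᵐ ω ∂μ, ω ∈ A → ∃ r, p r ω) : ∃ r, μ {ω | ω ∈ A ∧ p r ω} ≠ 0 := by
  by_contra! h0
  refine hA (measure_eq_zero_iff_ae_notMem.2 ?_)
  filter_upwards [h, ae_all_iff.2 fun r => measure_eq_zero_iff_ae_notMem.1 (h0 r)] with ω h1 h2 hω
  obtain ⟨r, hr⟩ := h1 hω
  exact h2 r ⟨hω, hr⟩

theorem le_biconjC_of_isLscC [IsProbabilityMeasure μ] (hP : IsRLCModule P)
    (hE : HasCountableConcatenation μ E) (hproper : IsProper f) (hlsc : IsLscC P f)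
    (hconv : IsL0Convex f) (x : E) : f x ≤ biconjC P f x := by
  by_contra hnot
  have hA : μ {ω | biconjC P f x ω < f x ω} ≠ 0 := fun h0 => hnot <| by
    rw [← AEEqFun.coeFn_le]
    filter_upwards [measure_eq_zero_iff_ae_notMem.1 h0] with ω h using not_lt.1 h
  have hAm : MeasurableSet {ω | biconjC P f x ω < f x ω} :=
    measurableSet_lt (biconjC P f x).measurable (f x).measurable
  obtain ⟨x₀, hx₀⟩ := hproper.1
  -- Lower bound by a seminorm, obtained from semicontinuity at `x₀`.
  obtain ⟨c₀, hc₀⟩ := exists_rat_measure_ne_zero hA (p := fun r ω => ((r : ℝ) : EReal) < f x₀ ω) (by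
    filter_upwards [hproper.2 x₀] with ω h _
    obtain ⟨r, -, hr⟩ := EReal.lt_iff_exists_rat_btwn.1 h
    exact ⟨r, hr⟩)
  obtain ⟨D₀, hD₀, hD₀m, hμD₀, q₀, hq₀, ε₀, hε₀, hball₀⟩ := exists_lt_on_ball hP hE hproper hlsc
    hconv (hAm.inter (measurableSet_lt measurable_const (f x₀).measurable)) hc₀ x₀ c₀
    fun ω hω => hω.2
  obtain ⟨r, hr⟩ := L0.exists_coe_eq (μ := μ) (φ := fun ω => (f x₀ ω).toReal)
    (measurable_ereal_toReal.comp (f x₀).measurable)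
  obtain ⟨q₁, hq₁, hlow₁⟩ := hconv.exists_lower_bound_of_finite hproper.2 (r := r) (by
    filter_upwards [hr, hx₀] with ω h1 h2
    rw [h1, EReal.coe_toReal h2.2 h2.1]) hq₀ hε₀ hball₀
  obtain ⟨b, hb⟩ := L0.exists_coe_eq (μ := μ) (φ := fun ω => c₀ - q₁ (x - x₀) ω)
    (measurable_const.sub (q₁ (x - x₀)).measurable)
  have hlow : ∀ z, ∀ᵐ ω ∂μ, ω ∈ D₀ → ((b ω - q₁ z ω : ℝ) : EReal) ≤ f (x + z) ω := by
    intro z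
    have h := hlow₁ (x - x₀ + z)
    rw [← add_assoc, add_sub_cancel] at h
    filter_upwards [h, hb, L0.le_iff.1 (hq₁.1.add_le (x - x₀) z), L0.coe_add (q₁ (x - x₀)) (q₁ z)]
      with ω h1 h2 h3 h4 hω
    refine le_trans (EReal.coe_le_coe_iff.2 ?_) (h1 hω)
    rw [h2]
    rw [h4] at h3
    linarith
  -- A constant `c` strictly between the biconjugate and `f` at `x`.
  obtain ⟨c, hc⟩ := exists_rat_measure_ne_zero hμD₀
    (p := fun r ω => biconjC P f x ω < ((r : ℝ) : EReal) ∧ ((r : ℝ) : EReal) < f x ω)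
    (Filter.Eventually.of_forall fun ω hω => EReal.lt_iff_exists_rat_btwn.1 (hD₀ hω).1)
  obtain ⟨D, hD, hDm, hμD, q, hq, ε, hε, hball⟩ := exists_lt_on_ball hP hE hproper hlsc
    hconv (hD₀m.inter ((measurableSet_lt (biconjC P f x).measurable measurable_const).inter
      (measurableSet_lt measurable_const (f x).measurable))) hc x c fun ω hω => hω.2.2
  obtain ⟨q₂, hq₂, hlow₂⟩ := hconv.exists_lower_bound_of_ball hq hε hball hq₁ fun z => by
    filter_upwards [hlow z] with ω h hω using h (hD hω).1
  obtain ⟨g, hg, hgf⟩ := hconv.exists_affine_le hproper hDm hq₂ hlow₂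
  refine hμD (measure_eq_zero_iff_ae_notMem.2 ?_)
  filter_upwards [le_biconjC hDm ⟨g, hg⟩ hgf] with ω h hω
  exact (h hω).not_gt (hD hω).2.1

end Conjugate

end RandomConvex

theorem theorem3p13 {Ω : Type*} [MeasurableSpace Ω] (μ : MeasureTheory.Measure Ω)
    [MeasureTheory.IsProbabilityMeasure μ]
    {E : Type*} [AddCommGroup E] [Module (RandomConvex.L0 μ) E]
    (P : Set (E → RandomConvex.L0 μ)) (hP : RandomConvex.IsRLCModule P)
    (hE : RandomConvex.HasCountableConcatenation μ E)
    (f : E → RandomConvex.L0bar μ) (hproper : RandomConvex.IsProper f)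
    (hlsc : RandomConvex.IsLscC P f) (hconv : RandomConvex.IsL0Convex f) :
    RandomConvex.biconjC P f = f :=
  funext fun x => le_antisymm (RandomConvex.biconjC_le P f x)
    (RandomConvex.le_biconjC_of_isLscC hP hE hproper hlsc hconv x)
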